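/- Consider initial value problems $y'(t)+My(t)=f(y(t))$, $t\in[t_0,t_{\rm end}]$, $y(t_0)=y_0$ in $\mathbb R^m$ ($m$ arbitrary, $t_0<t_{\rm end}$), where $M\in\mathbb R^{m\times m}$ is symmetric positive definite or skew-Hermitian ($M^{\mathsf T}=-M$) and $f:\mathbb R^m\to\mathbb R^m$ is four times continuously differentiable near $y_0$. Put $g(y)=-My+f(y)$. For real coefficients $a_{ij},b_i$ ($i,j=1,2$) and $c_i=a_{i1}+a_{i2}$, the two-stage IMMVERK method with step size $h$ is $$Y_i=y_0+h\sum_{j=1}^2a_{ij}\bigl(-MY_j+f(Y_j)\bigr)\quad(i=1,2),\qquad y_1=e^{-hM}y_0+h\bigl(b_1f(Y_1)+b_2f(Y_2)\bigr)+\bar w_4,$$ where, with all derivatives of $f$ taken at $y_0$ and $g=g(y_0)$, $$\bar w_4=-\tfrac{h^2}{2!}Mf(y_0)+\tfrac{h^3}{3!}\bigl(M^2f(y_0)-Mf'g\bigr)+\tfrac{h^4}{4!}\bigl(-M^3f(y_0)+M^2f'g-Mf''(g,g)-Mf'(-M+f')g\bigr).$$ The method is said to have order four if for every such problem and every exact solution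 $y$ of it there are $\rho,\delta>0$ and $C$ such that for all $0<h<\delta$ the stage equations have exactly one solution $(Y_1,Y_2)$ with $\|Y_i-y_0\|<\rho$, and the resulting $y_1$ satisfies $\|y(t_0+h)-y_1\|\le C h^5$. Theorem. (i) If the coefficients satisfy the classical fourth-order conditions $$\sum_i b_i=1,\quad \sum_i b_ic_i=\tfrac12,\quad \sum_i b_ic_i^2=\tfrac13,\quad \sum_{i,j}b_ia_{ij}c_j=\tfrac16,$$ $$\sum_i b_ic_i^3=\tfrac14,\quad \sum_{i,j}b_ic_ia_{ij}c_j=\tfrac18,\quad \sum_{i,j}b_ia_{ij}c_j^2=\tfrac1{12},\quad \sum_{i,j,k}b_ia_{ij}a_{jk}c_k=\tfrac1{24},$$ then the method has order four. (ii) Up to renumbering the two stages, these conditions have exactly one solution, the Hammer--Hollingsworth coefficients $$a_{11}=a_{22}=\tfrac14,\quad a_{12}=\tfrac{3-2\sqrt3}{12},\quad a_{21}=\tfrac{3+2\sqrt3}{12},\quad b_1=b_2=\tfrac12 .$$ (iii) The method with these coefficients is, up to renumbering the stages, the unique two-stage IMMVERK method of order four: a two-stage IMMVERK method as above has order four if and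 only if its coefficients are, up to that renumbering, the Hammer--Hollingsworth coefficients. -/

import Mathlib

/-- The real coefficients of a two-stage implicit Runge-Kutta type method: the matrix `a` of the
internal stages and the weights `b` of the update. -/
@[ext]
structure TwoStageTableau where
  a : Matrix (Fin 2) (Fin 2) ℝ
  b : Fin 2 → ℝ

namespace TwoStageTableau

/-- The nodes `c i`, the row sums of `a`. -/
def c (T : TwoStageTableau) (i : Fin 2) : ℝ := T.a i 0 + T.a i 1

/-- The classical order conditions of fourth-order Runge-Kutta methods, for two stages. -/
structure OrderConditions (T : TwoStageTableau) : Prop where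
  sum_b : T.b 0 + T.b 1 = 1
  sum_bc : T.b 0 * T.c 0 + T.b 1 * T.c 1 = 1 / 2
  sum_bcc : T.b 0 * T.c 0 ^ 2 + T.b 1 * T.c 1 ^ 2 = 1 / 3
  sum_bac : T.b 0 * (T.a 0 0 * T.c 0 + T.a 0 1 * T.c 1)
    + T.b 1 * (T.a 1 0 * T.c 0 + T.a 1 1 * T.c 1) = 1 / 6
  sum_bccc : T.b 0 * T.c 0 ^ 3 + T.b 1 * T.c 1 ^ 3 = 1 / 4
  sum_bcac : T.b 0 * T.c 0 * (T.a 0 0 * T.c 0 + T.a 0 1 * T.c 1)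
    + T.b 1 * T.c 1 * (T.a 1 0 * T.c 0 + T.a 1 1 * T.c 1) = 1 / 8
  sum_bacc : T.b 0 * (T.a 0 0 * T.c 0 ^ 2 + T.a 0 1 * T.c 1 ^ 2)
    + T.b 1 * (T.a 1 0 * T.c 0 ^ 2 + T.a 1 1 * T.c 1 ^ 2) = 1 / 12
  sum_baac : (T.b 0 * T.a 0 0 + T.b 1 * T.a 1 0) * (T.a 0 0 * T.c 0 + T.a 0 1 * T.c 1)
    + (T.b 0 * T.a 0 1 + T.b 1 * T.a 1 1) * (T.a 1 0 * T.c 0 + T.a 1 1 * T.c 1) = 1 / 24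

/-- The same tableau with its stages numbered differently. -/
def relabel (T : TwoStageTableau) (σ : Equiv.Perm (Fin 2)) : TwoStageTableau where
  a := T.a.submatrix σ σ
  b := T.b ∘ σ

/-- The coefficients of the two-stage method of Hammer and Hollingsworth. -/
noncomputable def hammerHollingsworth : TwoStageTableau where
  a := !![1 / 4, (3 - 2 * √3) / 12; (3 + 2 * √3) / 12, 1 / 4]
  b := ![1 / 2, 1 / 2]

end TwoStageTableau

namespace IMMVERK

section Method

variable {E : Type*} [NormedAddCommGroup E] [NormedSpace ℝ E]

/-- The right-hand side `g(y) = -M y + f(y)` of the differential equation `y' + M y = f(y)`. -/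
def rhs (M : E →L[ℝ] E) (f : E → E) (y : E) : E := -M y + f y

/-- The correction term `w̄₄` of the update, for step size `h` and initial value `y₀`. -/
noncomputable def correction (M : E →L[ℝ] E) (f : E → E) (y₀ : E) (h : ℝ) : E :=
  let g : E := rhs M f y₀
  let f₁ : E →L[ℝ] E := fderiv ℝ f y₀
  let f₂ : E →L[ℝ] E →L[ℝ] E := fderiv ℝ (fderiv ℝ f) y₀
  (h ^ 2 / 2) • (-M (f y₀))
    + (h ^ 3 / 6) • (M (M (f y₀)) - M (f₁ g))
    + (h ^ 4 / 24) • (-M (M (M (f y₀))) + M (M (f₁ g)) - M (f₂ g g) - M (f₁ (-M g + f₁ g)))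

/-- `Y` solves the equations for the two internal stages, which are the Runge-Kutta stages for
the right-hand side `-M y + f(y)`. -/
def IsStages (T : TwoStageTableau) (M : E →L[ℝ] E) (f : E → E) (y₀ : E) (h : ℝ)
    (Y : Fin 2 → E) : Prop :=
  ∀ i, Y i = y₀ + h • (T.a i 0 • rhs M f (Y 0) + T.a i 1 • rhs M f (Y 1))

/-- The numerical solution after one step of size `h`, computed from the internal stages `Y`. -/
noncomputable def update (T : TwoStageTableau) (M : E →L[ℝ] E) (f : E → E) (y₀ : E) (h : ℝ)
    (Y : Fin 2 → E) : E :=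
  NormedSpace.exp (-(h • M)) y₀ + h • (T.b 0 • f (Y 0) + T.b 1 • f (Y 1)) + correction M f y₀ h

end Method

/-- The two-stage method with correction term `w̄₄` and coefficients `T` has order `p`: for each
initial value problem `y' + M y = f(y)`, `y(t₀) = y₀` in `ℝᵐ`, with `M` symmetric positive definite
or skew-Hermitian and with `f` of class `C^p` near `y₀`, the stage equations have, for all
sufficiently small step sizes `h > 0`, exactly one solution near `y₀`, and the numerical solution
computed from it agrees with the exact solution `y(t₀ + h)` up to an error `O(h ^ (p + 1))`. -/
def HasOrder (T : TwoStageTableau) (p : ℕ) : Prop :=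
  ∀ (m : ℕ) (M : Matrix (Fin m) (Fin m) ℝ) (f : EuclideanSpace ℝ (Fin m) → EuclideanSpace ℝ (Fin m))
    (t₀ tEnd : ℝ) (y : ℝ → EuclideanSpace ℝ (Fin m)),
    (M.PosDef ∨ M.conjTranspose = -M) →
    ContDiffAt ℝ p f (y t₀) →
    t₀ < tEnd →
    (∀ t ∈ Set.Icc t₀ tEnd, HasDerivWithinAt y
      (rhs (Matrix.toEuclideanCLM (n := Fin m) (𝕜 := ℝ) M) f (y t)) (Set.Icc t₀ tEnd) t) →
    ∃ ρ > 0, ∃ δ > 0, ∃ C : ℝ, ∀ h : ℝ, 0 < h → h < δ →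
      (∃! Y : Fin 2 → EuclideanSpace ℝ (Fin m), (∀ i, Y i ∈ Metric.ball (y t₀) ρ) ∧
        IsStages T (Matrix.toEuclideanCLM (n := Fin m) (𝕜 := ℝ) M) f (y t₀) h Y) ∧
      ∀ Y : Fin 2 → EuclideanSpace ℝ (Fin m), (∀ i, Y i ∈ Metric.ball (y t₀) ρ) →
        IsStages T (Matrix.toEuclideanCLM (n := Fin m) (𝕜 := ℝ) M) f (y t₀) h Y →
        ‖y (t₀ + h) -
          update T (Matrix.toEuclideanCLM (n := Fin m) (𝕜 := ℝ) M) f (y t₀) h Y‖ ≤ C * h ^ (p + 1)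

end IMMVERK

/-!
Variation of constants separates the linear part of the equation: `y - exp(-(t - t₀) M) y₀` solves a
linear equation `z' = -M z + F` driven by `F = f ∘ y`. In its Taylor expansion at `t₀` the terms
containing `M` are exactly the correction term `w̄₄`, and the remaining ones are the expansion of
`∫ F` over the step (`isBigO_solution_sub_correction`). Hence the method has order four as soon as
`∑ bᵢ f(Yᵢ)` agrees with the mean value of `F` over the step up to `O(h ^ 4)`.

For that, the order conditions first determine the tableau up to renumbering
(`TwoStageTableau.orderConditions_iff`): the moments `∑ bᵢ cᵢᵏ` for `k ≤ 3` force the two-point Gauss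
nodes and weights, and two further conditions force `∑ⱼ aᵢⱼ cⱼ = cᵢ² / 2`. The method is therefore a
collocation method, and the defect of the exact solution in the stage equations is of size `h ^ 3`.
The stages inherit it (`IsStages.isBigO_sub_exact`), and the weights annihilate its leading term
(`IsStages.isBigO_sum_sub_exact`), so that what is left is the error of Gaussian quadrature
(`isBigO_sub_update`). Stages exist and are locally unique by the contraction principle
(`eventually_existsUnique_isStages`).

Conversely, `M = 0` is skew-Hermitian, and for it the method is a classical Runge-Kutta method. A
single polynomial triangular system in `ℝ⁸`, with one component for each rooted tree with at most
four vertices, then has the residuals of the eight order conditions as the coefficients of its local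
error (`HasOrder.orderConditions`).
-/

open Filter Topology Asymptotics Set

/-! ### The order conditions -/

namespace TwoStageTableau

namespace OrderConditions

variable {T : TwoStageTableau}

/-- The moments `mₖ = ∑ bᵢ cᵢᵏ` satisfy `mₖ₊₂ = (c₀ + c₁) mₖ₊₁ - c₀ c₁ mₖ`; as they are prescribed
for `k ≤ 3`, the recurrence determines the sum and the product of the nodes. -/
theorem c_add_c (hT : T.OrderConditions) : T.c 0 + T.c 1 = 1 := by
  linear_combination 12 * (hT.sum_bccc - (T.c 0 + T.c 1) * hT.sum_bcc + T.c 0 * T.c 1 * hT.sum_bc)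
    - 6 * (hT.sum_bcc - (T.c 0 + T.c 1) * hT.sum_bc + T.c 0 * T.c 1 * hT.sum_b)

theorem c_mul_c (hT : T.OrderConditions) : T.c 0 * T.c 1 = 1 / 6 := by
  linear_combination 1 / 2 * hT.c_add_c
    - (hT.sum_bcc - (T.c 0 + T.c 1) * hT.sum_bc + T.c 0 * T.c 1 * hT.sum_b)

theorem c_sub_c_sq (hT : T.OrderConditions) : (T.c 0 - T.c 1) ^ 2 = 1 / 3 := by
  linear_combination (T.c 0 + T.c 1 + 1) * hT.c_add_c - 4 * hT.c_mul_c

theorem c_sub_c_ne_zero (hT : T.OrderConditions) : T.c 0 - T.c 1 ≠ 0 := fun h => by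
  simpa [h] using hT.c_sub_c_sq

theorem b_zero (hT : T.OrderConditions) : T.b 0 = 1 / 2 := by
  refine mul_right_cancel₀ hT.c_sub_c_ne_zero ?_
  linear_combination hT.sum_bc - T.c 1 * hT.sum_b - 1 / 2 * hT.c_add_c

theorem b_one (hT : T.OrderConditions) : T.b 1 = 1 / 2 := by
  linear_combination hT.sum_b - hT.b_zero

/-- The stages integrate linear functions exactly. Together with the row sums this determines the
matrix of a tableau from its nodes. -/
theorem sum_ac (hT : T.OrderConditions) (i : Fin 2) :
    T.a i 0 * T.c 0 + T.a i 1 * T.c 1 = T.c i ^ 2 / 2 := by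
  have h1 := hT.sum_bac
  have h2 := hT.sum_bcac
  rw [hT.b_zero, hT.b_one] at h1 h2
  have hs := hT.c_add_c
  have hp := hT.c_mul_c
  have hc1 : T.c 1 = 1 - T.c 0 := by linear_combination hs
  fin_cases i <;> refine mul_right_cancel₀ hT.c_sub_c_ne_zero ?_ <;>
    simp only [Fin.zero_eta, Fin.mk_one, Fin.isValue]
  · generalize T.a 0 0 * T.c 0 + T.a 0 1 * T.c 1 = e₀ at *
    generalize T.a 1 0 * T.c 0 + T.a 1 1 * T.c 1 = e₁ at *
    rw [hc1] at h2 hp ⊢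
    linear_combination 2 * h2 - 2 * (1 - T.c 0) * h1 + (T.c 0 + 1 / 2) * hp
  · generalize T.a 0 0 * T.c 0 + T.a 0 1 * T.c 1 = e₀ at *
    generalize T.a 1 0 * T.c 0 + T.a 1 1 * T.c 1 = e₁ at *
    rw [hc1] at h2 hp ⊢
    linear_combination -2 * h2 + 2 * T.c 0 * h1 + (T.c 0 - 3 / 2) * hp

/-- The nodes do not precede the initial time, where the exact solution need not be defined. -/
theorem c_nonneg (hT : T.OrderConditions) (i : Fin 2) : 0 ≤ T.c i := by
  have hs := hT.c_add_c
  have hp := hT.c_mul_c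
  fin_cases i <;> simp only [Fin.zero_eta, Fin.mk_one, Fin.isValue] <;>
    nlinarith [sq_nonneg (T.c 0), sq_nonneg (T.c 1)]

theorem sum_b_defect (hT : T.OrderConditions) :
    T.b 0 * (T.c 0 ^ 3 / 6 - (T.a 0 0 * T.c 0 ^ 2 + T.a 0 1 * T.c 1 ^ 2) / 2)
      + T.b 1 * (T.c 1 ^ 3 / 6 - (T.a 1 0 * T.c 0 ^ 2 + T.a 1 1 * T.c 1 ^ 2) / 2) = 0 := by
  linear_combination 1 / 6 * hT.sum_bccc - 1 / 2 * hT.sum_bacc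

theorem relabel (hT : T.OrderConditions) (σ : Equiv.Perm (Fin 2)) :
    (T.relabel σ).OrderConditions := by
  obtain ⟨h1, h2, h3, h4, h5, h6, h7, h8⟩ := hT
  have hσ : σ 0 = 0 ∧ σ 1 = 1 ∨ σ 0 = 1 ∧ σ 1 = 0 := by
    revert σ; decide
  obtain ⟨e0, e1⟩ | ⟨e0, e1⟩ := hσ <;>
    simp only [c] at h1 h2 h3 h4 h5 h6 h7 h8 <;>
    constructor <;>
    simp only [c, TwoStageTableau.relabel, Matrix.submatrix_apply, Function.comp_apply, e0, e1] <;>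
    linarith

end OrderConditions

theorem orderConditions_hammerHollingsworth : hammerHollingsworth.OrderConditions := by
  have h3 : √3 ^ 2 = 3 := Real.sq_sqrt (by norm_num)
  constructor <;> simp [hammerHollingsworth, c] <;> ring_nf <;> simp only [h3] <;> ring

/-- Two tableaux that satisfy the order conditions and have the same first node are equal. -/
theorem OrderConditions.eq_of_c_zero_eq {S T : TwoStageTableau} (hS : S.OrderConditions)
    (hT : T.OrderConditions) (h0 : S.c 0 = T.c 0) : S = T := by
  have h1 : S.c 1 = T.c 1 := by linear_combination hS.c_add_c - hT.c_add_c - h0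
  have ha0 : ∀ i, S.c i = T.c i → S.a i 0 = T.a i 0 := fun i hi => by
    have hSi := hS.sum_ac i
    have hTi := hT.sum_ac i
    have hci : S.a i 0 + S.a i 1 = T.a i 0 + T.a i 1 := hi
    rw [h0, h1, hi] at hSi
    refine mul_right_cancel₀ hT.c_sub_c_ne_zero ?_
    linear_combination hSi - hTi - T.c 1 * hci
  have ha1 : ∀ i, S.c i = T.c i → S.a i 1 = T.a i 1 := fun i hi => by
    have hci : S.a i 0 + S.a i 1 = T.a i 0 + T.a i 1 := hi
    linear_combination hci - ha0 i hi
  ext i j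
  · fin_cases i <;> fin_cases j
    exacts [ha0 0 h0, ha1 0 h0, ha0 1 h1, ha1 1 h1]
  · fin_cases i
    exacts [hS.b_zero.trans hT.b_zero.symm, hS.b_one.trans hT.b_one.symm]

theorem orderConditions_iff {T : TwoStageTableau} :
    T.OrderConditions ↔ ∃ σ : Equiv.Perm (Fin 2), T = hammerHollingsworth.relabel σ := by
  refine ⟨fun hT => ?_, ?_⟩
  · have hH := orderConditions_hammerHollingsworth
    -- Both first nodes are roots of `x ^ 2 - x + 1 / 6`, whose roots are the two nodes.
    have hmul : (T.c 0 - hammerHollingsworth.c 0) * (T.c 0 - hammerHollingsworth.c 1) = 0 := by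
      linear_combination hH.c_mul_c - hT.c_mul_c + T.c 0 * hT.c_add_c - T.c 0 * hH.c_add_c
    rcases mul_eq_zero.mp hmul with h | h
    · exact ⟨1, hT.eq_of_c_zero_eq (hH.relabel 1) (sub_eq_zero.mp h)⟩
    · refine ⟨Equiv.swap 0 1, hT.eq_of_c_zero_eq (hH.relabel _) ((sub_eq_zero.mp h).trans ?_)⟩
      simp [c, relabel, add_comm]
  · rintro ⟨σ, rfl⟩
    exact orderConditions_hammerHollingsworth.relabel σ

end TwoStageTableau

/-! ### Necessity of the order conditions -/

theorem eq_zero_of_abs_mul_pow_le {x C δ : ℝ} {k p : ℕ} (hkp : k < p) (hδ : 0 < δ)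
    (H : ∀ h : ℝ, 0 < h → h < δ → |x * h ^ k| ≤ C * h ^ p) : x = 0 := by
  have hlim : Tendsto (fun h : ℝ => C * h ^ (p - k)) (𝓝[>] 0) (𝓝 0) := by
    have : Tendsto (fun h : ℝ => C * h ^ (p - k)) (𝓝 0) (𝓝 (C * 0 ^ (p - k))) :=
      (by fun_prop : Continuous fun h : ℝ => C * h ^ (p - k)).tendsto 0
    rw [zero_pow (by omega), mul_zero] at this
    exact this.mono_left nhdsWithin_le_nhds
  have hle : |x| ≤ 0 := by
    refine ge_of_tendsto hlim ?_
    filter_upwards [Ioo_mem_nhdsGT hδ] with h hh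
    have h1 := H h hh.1 hh.2
    have hk : 0 < h ^ k := pow_pos hh.1 k
    rw [abs_mul, abs_of_pos hk, show p = (p - k) + k by omega, pow_add, ← mul_assoc] at h1
    exact le_of_mul_le_mul_right h1 hk
  exact abs_nonpos_iff.mp hle

namespace IMMVERK

/-- The right-hand side of an autonomous triangular system in `ℝ⁸`. The component `x 0` is the time.
Each component belongs to one of the eight rooted trees with at most four vertices, in the order of
the fields of `TwoStageTableau.OrderConditions`. -/
def treeField (x : EuclideanSpace ℝ (Fin 8)) : EuclideanSpace ℝ (Fin 8) :=
  !₂[1, x 0, x 0 ^ 2, x 1, x 0 ^ 3, x 0 * x 1, x 2, x 3]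

/-- The solution of `x' = treeField x` with `x(0) = 0`. -/
noncomputable def treeSolution (t : ℝ) : EuclideanSpace ℝ (Fin 8) :=
  !₂[t, t ^ 2 / 2, t ^ 3 / 3, t ^ 3 / 6, t ^ 4 / 4, t ^ 4 / 8, t ^ 4 / 12, t ^ 4 / 24]

theorem contDiff_treeField {n : WithTop ℕ∞} : ContDiff ℝ n treeField := by
  rw [contDiff_euclidean]
  intro i
  fin_cases i <;> simp [treeField] <;> fun_prop

theorem hasDerivAt_treeSolution (t : ℝ) :
    HasDerivAt treeSolution (treeField (treeSolution t)) t := by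
  have key : ∀ (n : ℕ) (r : ℝ), HasDerivAt (fun t : ℝ => t ^ n / r) (n * t ^ (n - 1) / r) t :=
    fun n r => (hasDerivAt_pow n t).div_const r
  have hpi : HasDerivAt (fun t => (treeSolution t).ofLp) (treeField (treeSolution t)).ofLp t := by
    rw [hasDerivAt_pi]
    intro i
    fin_cases i
    · exact hasDerivAt_id t
    · exact (key 2 2).congr_deriv (by simp [treeField, treeSolution])
    · exact (key 3 3).congr_deriv (by simp [treeField, treeSolution])
    · exact (key 3 6).congr_deriv (by simp [treeField, treeSolution]; ring)
    · exact (key 4 4).congr_deriv (by simp [treeField, treeSolution])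
    · exact (key 4 8).congr_deriv (by simp [treeField, treeSolution]; ring)
    · exact (key 4 12).congr_deriv (by simp [treeField, treeSolution]; ring)
    · exact (key 4 24).congr_deriv (by simp [treeField, treeSolution]; ring)
  exact (PiLp.continuousLinearEquiv 2 ℝ (fun _ : Fin 8 => ℝ)).symm.hasFDerivAt.comp_hasDerivAt t hpi

/-- A method of order four satisfies the classical order conditions: with `M = 0` it is a classical
Runge-Kutta method, and the components of its error for `treeField` are the residuals of the eight
conditions, each multiplied by a power of the step size below the fifth. -/
theorem HasOrder.orderConditions {T : TwoStageTableau} (hT : HasOrder T 4) :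
    T.OrderConditions := by
  have h0 : treeSolution 0 = 0 := by
    ext i; fin_cases i <;> simp [treeSolution]
  obtain ⟨ρ, -, δ, hδ, C, H⟩ := hT 8 0 treeField 0 1 treeSolution (Or.inr (by simp))
    contDiff_treeField.contDiffAt one_pos (fun t _ => by
      simpa [rhs] using (hasDerivAt_treeSolution t).hasDerivWithinAt)
  have coord : ∀ (k : Fin 8) (x : ℝ) (n : ℕ), n < 5 →
      (∀ h Y, IsStages T 0 treeField 0 h Y →
        treeSolution h k - h * (T.b 0 * treeField (Y 0) k + T.b 1 * treeField (Y 1) k)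
          = x * h ^ n) → x = 0 := by
    intro k x n hn hx
    refine eq_zero_of_abs_mul_pow_le (C := C) hn hδ fun h hh hhδ => ?_
    obtain ⟨⟨Y, ⟨hYρ, hY⟩, -⟩, H2⟩ := H h hh hhδ
    have h2 := (PiLp.norm_apply_le _ k).trans (H2 Y hYρ hY)
    rw [h0, map_zero] at hY
    rw [← hx h Y hY]
    simpa [update, correction, h0, mul_add] using h2
  have stage : ∀ h Y, IsStages T 0 treeField 0 h Y → ∀ i k, Y i k =
      h * (T.a i 0 * treeField (Y 0) k + T.a i 1 * treeField (Y 1) k) := by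
    intro h Y hY i k
    conv_lhs => rw [hY i]
    simp [rhs, mul_add]
  -- Componentwise, the triangular system gives the stages explicitly.
  have s0 : ∀ h Y, IsStages T 0 treeField 0 h Y → ∀ i, Y i 0 = h * T.c i := by
    intro h Y hY i
    rw [stage h Y hY i 0]
    simp [treeField, TwoStageTableau.c]
  have s1 : ∀ h Y, IsStages T 0 treeField 0 h Y → ∀ i,
      Y i 1 = h ^ 2 * (T.a i 0 * T.c 0 + T.a i 1 * T.c 1) := by
    intro h Y hY i
    rw [stage h Y hY i 1]
    simp [treeField, s0 h Y hY]
    ring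
  have s2 : ∀ h Y, IsStages T 0 treeField 0 h Y → ∀ i,
      Y i 2 = h ^ 3 * (T.a i 0 * T.c 0 ^ 2 + T.a i 1 * T.c 1 ^ 2) := by
    intro h Y hY i
    rw [stage h Y hY i 2]
    simp [treeField, s0 h Y hY]
    ring
  have s3 : ∀ h Y, IsStages T 0 treeField 0 h Y → ∀ i,
      Y i 3 = h ^ 3 * (T.a i 0 * (T.a 0 0 * T.c 0 + T.a 0 1 * T.c 1)
        + T.a i 1 * (T.a 1 0 * T.c 0 + T.a 1 1 * T.c 1)) := by
    intro h Y hY i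
    rw [stage h Y hY i 3]
    simp [treeField, s1 h Y hY]
    ring
  constructor <;> rw [eq_comm, ← sub_eq_zero]
  · refine coord 0 _ 1 (by norm_num) fun h Y hY => ?_
    simp [treeField, treeSolution]; ring
  · refine coord 1 _ 2 (by norm_num) fun h Y hY => ?_
    simp [treeField, treeSolution, s0 h Y hY]; ring
  · refine coord 2 _ 3 (by norm_num) fun h Y hY => ?_
    simp [treeField, treeSolution, s0 h Y hY]; ring
  · refine coord 3 _ 3 (by norm_num) fun h Y hY => ?_
    simp [treeField, treeSolution, s1 h Y hY]; ring
  · refine coord 4 _ 4 (by norm_num) fun h Y hY => ?_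
    simp [treeField, treeSolution, s0 h Y hY]; ring
  · refine coord 5 _ 4 (by norm_num) fun h Y hY => ?_
    simp [treeField, treeSolution, s0 h Y hY, s1 h Y hY]; ring
  · refine coord 6 _ 4 (by norm_num) fun h Y hY => ?_
    simp [treeField, treeSolution, s2 h Y hY]; ring
  · refine coord 7 _ 4 (by norm_num) fun h Y hY => ?_
    simp [treeField, treeSolution, s3 h Y hY]; ring

end IMMVERK

/-! ### Taylor expansions -/

section Taylor

variable {E : Type*} [NormedAddCommGroup E] [NormedSpace ℝ E]

theorem ContDiffOn.taylor_isBigO {u : ℝ → E} {t₀ t₁ : ℝ} {n : ℕ} (ht : t₀ < t₁)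
    (hu : ContDiffOn ℝ (n + 1) u (Icc t₀ t₁)) {c : ℝ} (hc : 0 ≤ c) :
    (fun h : ℝ => u (t₀ + c * h) - ∑ k ∈ Finset.range (n + 1),
      ((c * h) ^ k / k.factorial) • iteratedDerivWithin k u (Icc t₀ t₁) t₀)
      =O[𝓝[>] 0] fun h => h ^ (n + 1) := by
  obtain ⟨C, hC⟩ := exists_taylor_mean_remainder_bound ht.le hu
  refine IsBigO.of_bound (C * c ^ (n + 1)) ?_
  have hev : ∀ᶠ h : ℝ in 𝓝[>] 0, c * h < t₁ - t₀ := by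
    have : Tendsto (fun h : ℝ => c * h) (𝓝[>] 0) (𝓝 0) := by
      have := ((continuous_const_mul c).tendsto 0).mono_left (nhdsWithin_le_nhds (s := Ioi 0))
      simpa using this
    exact this.eventually (gt_mem_nhds (sub_pos.mpr ht))
  filter_upwards [hev, self_mem_nhdsWithin] with h h1 (h2 : 0 < h)
  have h3 : 0 ≤ c * h := mul_nonneg hc h2.le
  have := hC (t₀ + c * h) ⟨by linarith, by linarith⟩
  rw [taylor_within_apply] at this
  simp only [add_sub_cancel_left, mul_pow] at this
  rw [Real.norm_of_nonneg (by positivity), mul_assoc]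
  convert this using 7
  rw [mul_pow]; ring

/-- The quadratic Taylor remainder, locally uniformly in the base point. -/
theorem ContDiffAt.isBigO_sub_sub_fderiv {F : Type*} [NormedAddCommGroup F] [NormedSpace ℝ F]
    {f : E → F} {x : E} (hf : ContDiffAt ℝ 2 f x) :
    (fun p : E × E => f p.1 - f p.2 - fderiv ℝ f x (p.1 - p.2))
      =O[𝓝 (x, x)] fun p => ‖p - (x, x)‖ * ‖p.1 - p.2‖ := by
  have hd : DifferentiableAt ℝ (fderiv ℝ f) x :=
    (hf.fderiv_right (m := 1) (by norm_num)).differentiableAt (by norm_num)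
  obtain ⟨C, hC⟩ := hd.isBigO_sub.bound
  have hev := hC.and ((hf.eventually (by simp)).mono fun z hz => hz.differentiableAt (by norm_num))
  obtain ⟨r, hr, hball⟩ := Metric.eventually_nhds_iff_ball.mp hev
  refine IsBigO.of_bound |C| ?_
  filter_upwards [Metric.ball_mem_nhds (x, x) hr] with p hp
  rw [mem_ball_iff_norm] at hp
  have hsub : ∀ z ∈ Metric.closedBall x ‖p - (x, x)‖, z ∈ Metric.ball x r := fun z hz =>
    Metric.mem_ball.mpr ((Metric.mem_closedBall.mp hz).trans_lt hp)
  have := (convex_closedBall x ‖p - (x, x)‖).norm_image_sub_le_of_norm_fderiv_le' (𝕜 := ℝ) (f := f)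
    (x := p.2) (y := p.1) (φ := fderiv ℝ f x) (C := |C| * ‖p - (x, x)‖)
    (fun z hz => (hball z (hsub z hz)).2)
    (fun z hz => ((hball z (hsub z hz)).1.trans (mul_le_mul_of_nonneg_right (le_abs_self C)
      (norm_nonneg _))).trans (mul_le_mul_of_nonneg_left (mem_closedBall_iff_norm.mp hz)
        (abs_nonneg C)))
    (mem_closedBall_iff_norm.mpr (norm_snd_le (p - (x, x))))
    (mem_closedBall_iff_norm.mpr (norm_fst_le (p - (x, x))))
  rw [norm_mul, norm_norm, norm_norm, ← mul_assoc]
  exact this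

/-- The successive derivatives of a solution of the linear equation `u' = L u + F`. -/
theorem iteratedDerivWithin_succ_of_linear_ode {u F : ℝ → E} {s : Set ℝ} (L : E →L[ℝ] E)
    (hs : UniqueDiffOn ℝ s) {k : ℕ} (hu : ContDiffOn ℝ k u s) (hF : ContDiffOn ℝ k F s)
    (hode : ∀ t ∈ s, HasDerivWithinAt u (L (u t) + F t) s t) {t : ℝ} (ht : t ∈ s) :
    iteratedDerivWithin (k + 1) u s t
      = L (iteratedDerivWithin k u s t) + iteratedDerivWithin k F s t := by
  have hL : ContDiffOn ℝ k (fun t => L (u t)) s := L.contDiff.comp_contDiffOn hu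
  rw [iteratedDerivWithin_succ', iteratedDerivWithin_congr
    (fun t ht => (hode t ht).derivWithin (hs t ht)) ht,
    iteratedDerivWithin_fun_add ht hs (hL t ht) (hF t ht)]
  congr 1
  have := L.iteratedFDerivWithin_comp_left (hu t ht) hs ht le_rfl
  rw [iteratedDerivWithin_eq_iteratedFDerivWithin, iteratedDerivWithin_eq_iteratedFDerivWithin]
  exact congrArg (fun A => A fun _ => (1 : ℝ)) this

theorem contDiffOn_succ_of_hasDerivWithinAt {u v : ℝ → E} {s : Set ℝ} {n : ℕ}
    (hs : UniqueDiffOn ℝ s) (hu : ∀ t ∈ s, HasDerivWithinAt u (v t) s t)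
    (hv : ContDiffOn ℝ n v s) : ContDiffOn ℝ (n + 1) u s := by
  rw [contDiffOn_succ_iff_derivWithin hs]
  exact ⟨fun t ht => (hu t ht).differentiableWithinAt, by simp,
    hv.congr fun t ht => (hu t ht).derivWithin (hs t ht)⟩

/-- Bootstrapping: a solution of an autonomous equation is once more differentiable than the
vector field. -/
theorem contDiffOn_of_autonomous_ode {u : ℝ → E} {g : E → E} {s : Set ℝ} {n : ℕ}
    (hs : UniqueDiffOn ℝ s) (hg : ∀ t ∈ s, ContDiffAt ℝ n g (u t))
    (hu : ∀ t ∈ s, HasDerivWithinAt u (g (u t)) s t) : ContDiffOn ℝ (n + 1) u s := by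
  have key : ∀ k : ℕ, k ≤ n + 1 → ContDiffOn ℝ k u s := by
    intro k
    induction k with
    | zero =>
      intro _
      exact contDiffOn_zero.mpr fun t ht => (hu t ht).continuousWithinAt
    | succ k ih =>
      intro hk
      refine contDiffOn_succ_of_hasDerivWithinAt hs hu fun t ht => ?_
      exact ((hg t ht).of_le (by exact_mod_cast Nat.le_of_succ_le_succ hk)).comp_contDiffWithinAt t
        (ih (by omega) t ht)
  exact_mod_cast key (n + 1) le_rfl

end Taylor

namespace IMMVERK

/-! ### The internal stages -/

section Stages

variable {E : Type*} [NormedAddCommGroup E] [NormedSpace ℝ E]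

theorem contDiffAt_rhs {M : E →L[ℝ] E} {f : E → E} {y₀ : E} {n : WithTop ℕ∞}
    (hf : ContDiffAt ℝ n f y₀) : ContDiffAt ℝ n (rhs M f) y₀ :=
  M.contDiff.contDiffAt.neg.add hf

/-- For small step sizes the stage equations are a contraction of a small closed ball, and their
right-hand side is Lipschitz continuous on a larger open one. -/
theorem eventually_existsUnique_isStages [CompleteSpace E] (T : TwoStageTableau) {M : E →L[ℝ] E}
    {f : E → E} {y₀ : E} (hf : ContDiffAt ℝ 1 f y₀) :
    ∃ ρ > 0, (∃ B, ∀ x ∈ Metric.ball y₀ ρ, ‖rhs M f x‖ ≤ B) ∧ ∀ᶠ h : ℝ in 𝓝[>] 0,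
      ∃! Y : Fin 2 → E, (∀ i, Y i ∈ Metric.ball y₀ ρ) ∧ IsStages T M f y₀ h Y := by
  obtain ⟨K, t, ht, hK⟩ := (contDiffAt_rhs (M := M) hf).exists_lipschitzOnWith
  obtain ⟨ρ, hρ, hρt⟩ := Metric.mem_nhds_iff.mp ht
  replace hK := hK.mono hρt
  set g := rhs M f with hg
  have hLip : ∀ x ∈ Metric.ball y₀ ρ, ∀ z ∈ Metric.ball y₀ ρ, ‖g x - g z‖ ≤ K * ‖x - z‖ :=
    fun x hx z hz => by simpa [dist_eq_norm] using hK.dist_le_mul x hx z hz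
  set B : ℝ := K * ρ + ‖g y₀‖ with hB
  have hB0 : 0 ≤ B := by positivity
  have hbound : ∀ x ∈ Metric.ball y₀ ρ, ‖g x‖ ≤ B := fun x hx => by
    have h1 := hLip x hx y₀ (Metric.mem_ball_self hρ)
    have h2 : K * ‖x - y₀‖ ≤ K * ρ :=
      mul_le_mul_of_nonneg_left (mem_ball_iff_norm.mp hx).le K.2
    linarith [norm_le_norm_sub_add (g x) (g y₀)]
  refine ⟨ρ, hρ, ⟨B, hbound⟩, ?_⟩
  set α : ℝ := |T.a 0 0| + |T.a 0 1| + |T.a 1 0| + |T.a 1 1| with hα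
  have hα0 : 0 ≤ α := by positivity
  have hαi : ∀ i, |T.a i 0| + |T.a i 1| ≤ α := by
    have h00 := abs_nonneg (T.a 0 0)
    have h01 := abs_nonneg (T.a 0 1)
    have h10 := abs_nonneg (T.a 1 0)
    have h11 := abs_nonneg (T.a 1 1)
    intro i
    fin_cases i <;> simp only [Fin.zero_eta, Fin.mk_one, Fin.isValue] <;> linarith
  have hsum : ∀ (i : Fin 2) (u v : E) (D : ℝ), ‖u‖ ≤ D → ‖v‖ ≤ D →
      ‖T.a i 0 • u + T.a i 1 • v‖ ≤ α * D := by
    intro i u v D hu hv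
    have hD : 0 ≤ D := (norm_nonneg u).trans hu
    calc ‖T.a i 0 • u + T.a i 1 • v‖ ≤ |T.a i 0| * ‖u‖ + |T.a i 1| * ‖v‖ := by
          simpa [norm_smul] using norm_add_le (T.a i 0 • u) (T.a i 1 • v)
      _ ≤ |T.a i 0| * D + |T.a i 1| * D := by gcongr
      _ = (|T.a i 0| + |T.a i 1|) * D := by ring
      _ ≤ α * D := by gcongr; exact hαi i
  have hsmall : ∀ r s : ℝ, 0 < s → ∀ᶠ h : ℝ in 𝓝[>] 0, h * r < s := by
    intro r s hs
    have : Tendsto (fun h : ℝ => h * r) (𝓝[>] 0) (𝓝 0) := by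
      simpa using ((continuous_mul_const r).tendsto 0).mono_left nhdsWithin_le_nhds
    exact this.eventually (gt_mem_nhds hs)
  filter_upwards [hsmall (α * K) (1 / 2) (by norm_num), hsmall (α * B) (ρ / 2) (by positivity),
    self_mem_nhdsWithin] with h h1 h2 (hh : 0 < h)
  let Φ : (Fin 2 → E) → Fin 2 → E := fun Y i => y₀ + h • (T.a i 0 • g (Y 0) + T.a i 1 • g (Y 1))
  let S : Set (Fin 2 → E) := {Y | ∀ i, Y i ∈ Metric.closedBall y₀ (ρ / 2)}
  let U : Set (Fin 2 → E) := {Y | ∀ i, Y i ∈ Metric.ball y₀ ρ}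
  have hSU : S ⊆ U := fun Y hY i => Metric.closedBall_subset_ball (by linarith) (hY i)
  have hΦU : ∀ Y ∈ U, Φ Y ∈ S := fun Y hY i => by
    have := hsum i (g (Y 0)) (g (Y 1)) B (hbound _ (hY 0)) (hbound _ (hY 1))
    rw [mem_closedBall_iff_norm, add_sub_cancel_left, norm_smul, Real.norm_of_nonneg hh.le]
    exact (mul_le_mul_of_nonneg_left this hh.le).trans h2.le
  have hΦLip : LipschitzOnWith (1 / 2) Φ U := by
    refine LipschitzOnWith.of_dist_le_mul fun Y hY Z hZ => ?_
    have hD : ∀ j, ‖g (Y j) - g (Z j)‖ ≤ K * ‖Y - Z‖ := fun j =>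
      (hLip _ (hY j) _ (hZ j)).trans
        (mul_le_mul_of_nonneg_left (norm_le_pi_norm (Y - Z) j) K.2)
    rw [dist_eq_norm, dist_eq_norm, pi_norm_le_iff_of_nonneg (by positivity)]
    intro i
    have hi : (Φ Y - Φ Z) i
        = h • (T.a i 0 • (g (Y 0) - g (Z 0)) + T.a i 1 • (g (Y 1) - g (Z 1))) := by
      simp only [Φ, Pi.sub_apply]; module
    rw [hi, norm_smul, Real.norm_of_nonneg hh.le]
    calc h * _ ≤ h * (α * (K * ‖Y - Z‖)) :=
          mul_le_mul_of_nonneg_left (hsum i _ _ _ (hD 0) (hD 1)) hh.le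
      _ = (h * (α * K)) * ‖Y - Z‖ := by ring
      _ ≤ 1 / 2 * ‖Y - Z‖ := by gcongr
  have hcomplete : IsComplete S := by
    have : S = Set.pi univ fun _ => Metric.closedBall y₀ (ρ / 2) := by ext; simp [S]
    rw [this]
    exact (isClosed_set_pi fun _ _ => Metric.isClosed_closedBall).isComplete
  have hmaps : MapsTo Φ S S := fun Y hY => hΦU Y (hSU hY)
  have hhalf : (1 / 2 : NNReal) < 1 := by
    rw [← NNReal.coe_lt_coe]; norm_num
  have hcontr : ContractingWith (1 / 2) (hmaps.restrict Φ S S) :=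
    ⟨hhalf, fun x z => hΦLip (hSU x.2) (hSU z.2)⟩
  obtain ⟨Y, hYS, hYfix, -⟩ := hcontr.exists_fixedPoint' (x := fun _ => y₀) hcomplete hmaps
    (fun _ => Metric.mem_closedBall_self (by positivity)) (edist_ne_top _ _)
  refine ⟨Y, ⟨hSU hYS, fun i => (congrFun hYfix i).symm⟩, ?_⟩
  rintro Z ⟨hZU, hZ⟩
  have hZfix : Φ Z = Z := funext fun i => (hZ i).symm
  have h3 := hΦLip.dist_le_mul Z hZU Y (hSU hYS)
  rw [hZfix, hYfix.eq] at h3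
  have h4 : ((1 / 2 : NNReal) : ℝ) = 1 / 2 := by norm_num
  rw [h4] at h3
  exact dist_le_zero.mp (by linarith [dist_nonneg (x := Z) (y := Y)])

theorem IsStages.isBigO_sub {T : TwoStageTableau} {M : E →L[ℝ] E} {f : E → E} {y₀ : E} {ρ B : ℝ}
    (hB : ∀ x ∈ Metric.ball y₀ ρ, ‖rhs M f x‖ ≤ B) {Y : ℝ → Fin 2 → E}
    (hYρ : ∀ᶠ h in 𝓝[>] 0, ∀ i, Y h i ∈ Metric.ball y₀ ρ)
    (hY : ∀ᶠ h in 𝓝[>] 0, IsStages T M f y₀ h (Y h)) (i : Fin 2) :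
    (fun h => Y h i - y₀) =O[𝓝[>] 0] fun h => h := by
  have hj : ∀ j, (fun h => rhs M f (Y h j)) =O[𝓝[>] 0] fun _ => (1 : ℝ) := fun j =>
    IsBigO.of_bound B (hYρ.mono fun h hh => by simpa using hB _ (hh j))
  have := (isBigO_refl (fun h : ℝ => h) (𝓝[>] 0)).smul
    (((hj 0).const_smul_left (T.a i 0)).add ((hj 1).const_smul_left (T.a i 1)))
  refine (this.congr' (hY.mono fun h hh => ?_) (Eventually.of_forall fun h => by simp))
  beta_reduce
  conv_rhs => rw [hh i]
  simp

end Stages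

end IMMVERK

namespace IMMVERK

/-! ### The local error -/

section LocalError

variable {E : Type*} [NormedAddCommGroup E] [NormedSpace ℝ E]

theorem isBigO_pow_pow_of_le {k n : ℕ} (hkn : k ≤ n) :
    (fun h : ℝ => h ^ n) =O[𝓝[>] 0] fun h => h ^ k := by
  refine IsBigO.of_bound 1 ?_
  filter_upwards [Ioo_mem_nhdsGT one_pos] with h hh
  rw [one_mul, Real.norm_of_nonneg (pow_nonneg hh.1.le n),
    Real.norm_of_nonneg (pow_nonneg hh.1.le k)]
  exact pow_le_pow_of_le_one hh.1.le hh.2.le hkn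

theorem _root_.Asymptotics.IsBigO.id_smul {u : ℝ → E} {k : ℕ}
    (hu : u =O[𝓝[>] 0] fun h => h ^ k) :
    (fun h => h • u h) =O[𝓝[>] 0] fun h => h ^ (k + 1) :=
  ((isBigO_refl (fun h : ℝ => h) (𝓝[>] 0)).smul hu).congr_right fun h => by
    simp [pow_succ, mul_comm]

variable {M : E →L[ℝ] E} {f : E → E} {y : ℝ → E} {t₀ t₁ : ℝ}

/-- The expansion of the stages around the exact solution at the nodes. The defect of the exact
solution in the stage equations starts with the third power of the step size, and the equations
transfer it to the stages. -/
theorem IsStages.isBigO_sub_exact {T : TwoStageTableau} (hT : T.OrderConditions) (ht : t₀ < t₁)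
    (hf : ∀ t ∈ Icc t₀ t₁, ContDiffAt ℝ 4 f (y t))
    (hy : ∀ t ∈ Icc t₀ t₁, HasDerivWithinAt y (rhs M f (y t)) (Icc t₀ t₁) t)
    {Y : ℝ → Fin 2 → E} (hY : ∀ᶠ h in 𝓝[>] 0, IsStages T M f (y t₀) h (Y h))
    (hYO : ∀ i, (fun h => Y h i - y t₀) =O[𝓝[>] 0] fun h => h) (i : Fin 2) :
    (fun h => Y h i - y (t₀ + T.c i * h)
      + (h ^ 3 * (T.c i ^ 3 / 6 - (T.a i 0 * T.c 0 ^ 2 + T.a i 1 * T.c 1 ^ 2) / 2)) •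
        iteratedDerivWithin 3 y (Icc t₀ t₁) t₀) =O[𝓝[>] 0] fun h => h ^ 4 := by
  have hI : UniqueDiffOn ℝ (Icc t₀ t₁) := uniqueDiffOn_Icc ht
  have ht₀ : t₀ ∈ Icc t₀ t₁ := left_mem_Icc.mpr ht.le
  have hy5 : ContDiffOn ℝ ((4 : ℕ) + 1) y (Icc t₀ t₁) :=
    contDiffOn_of_autonomous_ode (n := 4) hI
      (fun t h => (contDiffAt_rhs (hf t h))) hy
  have hv4 : ContDiffOn ℝ 4 (fun t => rhs M f (y t)) (Icc t₀ t₁) := fun t h =>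
    (contDiffAt_rhs (hf t h)).comp_contDiffWithinAt t ((hy5 t h).of_le (by norm_num))
  have hvD : ∀ k, iteratedDerivWithin k (fun t => rhs M f (y t)) (Icc t₀ t₁) t₀
      = iteratedDerivWithin (k + 1) y (Icc t₀ t₁) t₀ := fun k => by
    rw [iteratedDerivWithin_succ']
    exact iteratedDerivWithin_congr (fun t h => ((hy t h).derivWithin (hI t h)).symm) ht₀
  have hR : ∀ i, _ := fun i =>
    (hy5.of_le (by norm_num : ((3 : ℕ) : WithTop ℕ∞) + 1 ≤ (4 : ℕ) + 1)).taylor_isBigO ht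
      (hT.c_nonneg i)
  have hS : ∀ i, _ := fun i =>
    (hv4.of_le (by norm_num : ((2 : ℕ) : WithTop ℕ∞) + 1 ≤ 4)).taylor_isBigO ht (hT.c_nonneg i)
  simp only [hvD] at hS
  generalize hD : (fun k => iteratedDerivWithin k y (Icc t₀ t₁) t₀) = D at *
  have hD' : ∀ k, iteratedDerivWithin k y (Icc t₀ t₁) t₀ = D k := fun k => congrFun hD k
  have hD0 : D 0 = y t₀ := by rw [← hD', iteratedDerivWithin_zero]
  simp only [hD', Finset.sum_range_succ, Finset.sum_range_zero, hD0] at hR hS ⊢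
  -- The exact solution at the nodes stays close to the initial value.
  have hexact : ∀ j, (fun h => y (t₀ + T.c j * h) - y t₀) =O[𝓝[>] 0] fun h => h := fun j => by
    have := (hy5.of_le (by norm_num : ((0 : ℕ) : WithTop ℕ∞) + 1 ≤ (4 : ℕ) + 1)).taylor_isBigO ht
      (hT.c_nonneg j)
    simpa using this
  have hlim : ∀ j, Tendsto (fun h => (Y h j, y (t₀ + T.c j * h))) (𝓝[>] 0) (𝓝 (y t₀, y t₀)) := by
    have hid : Tendsto (fun h : ℝ => h) (𝓝[>] 0) (𝓝 0) := tendsto_id.mono_left nhdsWithin_le_nhds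
    intro j
    refine Tendsto.prodMk_nhds ?_ ?_
    · exact tendsto_sub_nhds_zero_iff.mp ((hYO j).trans_tendsto hid)
    · exact tendsto_sub_nhds_zero_iff.mp ((hexact j).trans_tendsto hid)
  have hgO : ∀ j, (fun h => rhs M f (Y h j) - rhs M f (y (t₀ + T.c j * h)))
      =O[𝓝[>] 0] fun h => Y h j - y (t₀ + T.c j * h) := fun j =>
    ((contDiffAt_rhs (M := M) (hf t₀ ht₀)).hasStrictFDerivAt
      (by norm_num)).isBigO_sub.comp_tendsto (hlim j)
  -- The stage equations carry a factor `h`: an error of order `k` in the stages reproduces the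
  -- leading term up to order `k + 1`, and starting from `k = 1` this is iterated up to `k = 3`.
  have hstep : ∀ k ≤ 3, (∀ j, (fun h => Y h j - y (t₀ + T.c j * h)) =O[𝓝[>] 0] fun h => h ^ k) →
      ∀ i, (fun h => Y h i - y (t₀ + T.c i * h)
        + (h ^ 3 * (T.c i ^ 3 / 6 - (T.a i 0 * T.c 0 ^ 2 + T.a i 1 * T.c 1 ^ 2) / 2)) • D 3)
          =O[𝓝[>] 0] fun h => h ^ (k + 1) := by
    intro k hk hO i
    have h1 := (((hgO 0).trans (hO 0)).const_smul_left (T.a i 0)).add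
      (((hgO 1).trans (hO 1)).const_smul_left (T.a i 1)) |>.id_smul
    have h2 := ((hS 0).const_smul_left (T.a i 0)).add ((hS 1).const_smul_left (T.a i 1)) |>.id_smul
    have h3 := ((h2.sub (hR i)).trans (isBigO_pow_pow_of_le (Nat.succ_le_succ hk))).add h1
    refine h3.congr' (hY.mono fun h hh => ?_) EventuallyEq.rfl
    have hac := hT.sum_ac i
    have hc : T.a i 0 + T.a i 1 = T.c i := rfl
    simp only [Pi.smul_apply, Nat.factorial]
    push_cast
    linear_combination (norm := module) -(h • (hc • D 1)) - (h ^ 2 • (hac • D 2)) - hh i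
  have hlow : ∀ k ≤ 2, (∀ j, (fun h => Y h j - y (t₀ + T.c j * h)) =O[𝓝[>] 0] fun h => h ^ k) →
      ∀ j, (fun h => Y h j - y (t₀ + T.c j * h)) =O[𝓝[>] 0] fun h => h ^ (k + 1) := by
    intro k hk hO j
    have h1 : (fun h : ℝ => (h ^ 3 * (T.c j ^ 3 / 6
        - (T.a j 0 * T.c 0 ^ 2 + T.a j 1 * T.c 1 ^ 2) / 2)) • D 3)
        =O[𝓝[>] 0] fun h => h ^ (k + 1) := by
      refine IsBigO.trans ?_ (isBigO_pow_pow_of_le (Nat.succ_le_succ hk))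
      exact (((isBigO_refl (fun h : ℝ => h ^ 3) (𝓝[>] 0)).mul (isBigO_refl (fun _ =>
        T.c j ^ 3 / 6 - (T.a j 0 * T.c 0 ^ 2 + T.a j 1 * T.c 1 ^ 2) / 2) _)).smul
        (isBigO_refl (fun _ => D 3) _)).trans
        (IsBigO.of_bound (‖T.c j ^ 3 / 6
          - (T.a j 0 * T.c 0 ^ 2 + T.a j 1 * T.c 1 ^ 2) / 2‖ * ‖D 3‖)
          (Eventually.of_forall fun h => by
            simp only [norm_smul, norm_mul]; exact le_of_eq (by ring)))
    exact ((hstep k (by omega) hO j).sub h1).congr_left fun h => by abel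
  refine hstep 3 le_rfl (hlow 2 le_rfl (hlow 1 (by norm_num) fun j => ?_)) i
  exact ((hYO j).sub (hexact j)).congr (fun h => by abel) (fun h => by simp)

/-- With the weights of the method the leading error terms of the stages cancel. -/
theorem IsStages.isBigO_sum_sub_exact {T : TwoStageTableau} (hT : T.OrderConditions) (ht : t₀ < t₁)
    (hf : ∀ t ∈ Icc t₀ t₁, ContDiffAt ℝ 4 f (y t))
    (hy : ∀ t ∈ Icc t₀ t₁, HasDerivWithinAt y (rhs M f (y t)) (Icc t₀ t₁) t)
    {Y : ℝ → Fin 2 → E} (hY : ∀ᶠ h in 𝓝[>] 0, IsStages T M f (y t₀) h (Y h))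
    (hYO : ∀ i, (fun h => Y h i - y t₀) =O[𝓝[>] 0] fun h => h) :
    (fun h => T.b 0 • (f (Y h 0) - f (y (t₀ + T.c 0 * h)))
      + T.b 1 • (f (Y h 1) - f (y (t₀ + T.c 1 * h)))) =O[𝓝[>] 0] fun h => h ^ 4 := by
  have ht₀ : t₀ ∈ Icc t₀ t₁ := left_mem_Icc.mpr ht.le
  have he := IsStages.isBigO_sub_exact hT ht hf hy hY hYO
  generalize iteratedDerivWithin 3 y (Icc t₀ t₁) t₀ = D at he
  have he3 : ∀ i, (fun h => Y h i - y (t₀ + T.c i * h)) =O[𝓝[>] 0] fun h => h ^ 3 := fun i => by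
    set κ := T.c i ^ 3 / 6 - (T.a i 0 * T.c 0 ^ 2 + T.a i 1 * T.c 1 ^ 2) / 2 with hκ
    have h1 : (fun h : ℝ => (h ^ 3 * κ) • D) =O[𝓝[>] 0] fun h => h ^ 3 :=
      IsBigO.of_bound (‖κ‖ * ‖D‖) (Eventually.of_forall fun h => by
        rw [norm_smul, norm_mul]; exact le_of_eq (by ring))
    exact (((he i).trans (isBigO_pow_pow_of_le (by norm_num))).sub h1).congr_left fun h => by
      abel
  have hexact : ∀ j, (fun h => y (t₀ + T.c j * h) - y t₀) =O[𝓝[>] 0] fun h => h := fun j => by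
    have h1 : (fun h => Y h j - y (t₀ + T.c j * h)) =O[𝓝[>] 0] fun h => h := by
      simpa using (he3 j).trans (isBigO_pow_pow_of_le (k := 1) (by norm_num))
    exact ((hYO j).sub h1).congr_left fun h => by abel
  have hid : Tendsto (fun h : ℝ => h) (𝓝[>] 0) (𝓝 0) := tendsto_id.mono_left nhdsWithin_le_nhds
  have hlim : ∀ j, Tendsto (fun h => (Y h j, y (t₀ + T.c j * h))) (𝓝[>] 0) (𝓝 (y t₀, y t₀)) :=
    fun j => (tendsto_sub_nhds_zero_iff.mp ((hYO j).trans_tendsto hid)).prodMk_nhds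
      (tendsto_sub_nhds_zero_iff.mp ((hexact j).trans_tendsto hid))
  have hf' : ∀ j, (fun h => f (Y h j) - f (y (t₀ + T.c j * h))
      - fderiv ℝ f (y t₀) (Y h j - y (t₀ + T.c j * h))) =O[𝓝[>] 0] fun h => h ^ 4 := fun j => by
    have h1 := ((hf t₀ ht₀).of_le (by norm_num : (2 : WithTop ℕ∞) ≤ 4)).isBigO_sub_sub_fderiv
      |>.comp_tendsto (hlim j)
    have h2 : (fun h => ‖(Y h j, y (t₀ + T.c j * h)) - (y t₀, y t₀)‖
        * ‖Y h j - y (t₀ + T.c j * h)‖) =O[𝓝[>] 0] fun h => h * h ^ 3 :=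
      ((hYO j).prod_left (hexact j)).norm_left.mul (he3 j).norm_left
    exact (h1.trans h2).congr_right fun h => by ring
  have hL := (fderiv ℝ f (y t₀)).isBigO_comp (fun h => T.b 0 • (Y h 0 - y (t₀ + T.c 0 * h))
      + T.b 1 • (Y h 1 - y (t₀ + T.c 1 * h))) (𝓝[>] 0)
  have hsum : (fun h => T.b 0 • (Y h 0 - y (t₀ + T.c 0 * h))
      + T.b 1 • (Y h 1 - y (t₀ + T.c 1 * h))) =O[𝓝[>] 0] fun h => h ^ 4 :=
    (((he 0).const_smul_left (T.b 0)).add ((he 1).const_smul_left (T.b 1))).congr_left fun h => by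
      simp only [Pi.smul_apply]
      linear_combination (norm := module) h ^ 3 • (hT.sum_b_defect • D)
  refine ((((hf' 0).const_smul_left (T.b 0)).add ((hf' 1).const_smul_left (T.b 1))).add
    (hL.trans hsum)).congr_left fun h => ?_
  simp only [Pi.smul_apply, map_add, map_smul]
  module

/-- The first two derivatives of `f` along the exact solution. -/
theorem iteratedDerivWithin_comp_solution (ht : t₀ < t₁)
    (hf : ∀ t ∈ Icc t₀ t₁, ContDiffAt ℝ 4 f (y t))
    (hy : ∀ t ∈ Icc t₀ t₁, HasDerivWithinAt y (rhs M f (y t)) (Icc t₀ t₁) t) :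
    iteratedDerivWithin 1 (fun t => f (y t)) (Icc t₀ t₁) t₀
        = fderiv ℝ f (y t₀) (rhs M f (y t₀)) ∧
      iteratedDerivWithin 2 (fun t => f (y t)) (Icc t₀ t₁) t₀
        = fderiv ℝ (fderiv ℝ f) (y t₀) (rhs M f (y t₀)) (rhs M f (y t₀))
          + fderiv ℝ f (y t₀) (-M (rhs M f (y t₀)) + fderiv ℝ f (y t₀) (rhs M f (y t₀))) := by
  have hI : UniqueDiffOn ℝ (Icc t₀ t₁) := uniqueDiffOn_Icc ht
  have ht₀ : t₀ ∈ Icc t₀ t₁ := left_mem_Icc.mpr ht.le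
  have h1 : ∀ t ∈ Icc t₀ t₁, HasDerivWithinAt (fun t => f (y t))
      (fderiv ℝ f (y t) (rhs M f (y t))) (Icc t₀ t₁) t := fun t h =>
    ((hf t h).differentiableAt (by norm_num)).hasFDerivAt.comp_hasDerivWithinAt t (hy t h)
  have hEq : EqOn (derivWithin (fun t => f (y t)) (Icc t₀ t₁))
      (fun t => fderiv ℝ f (y t) (rhs M f (y t))) (Icc t₀ t₁) := fun t h =>
    (h1 t h).derivWithin (hI t h)
  have hrhs : HasDerivWithinAt (fun t => rhs M f (y t))
      (-M (rhs M f (y t₀)) + fderiv ℝ f (y t₀) (rhs M f (y t₀))) (Icc t₀ t₁) t₀ :=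
    (M.hasFDerivAt.comp_hasDerivWithinAt t₀ (hy t₀ ht₀)).neg.add (h1 t₀ ht₀)
  have hf₁ : HasDerivWithinAt (fun t => fderiv ℝ f (y t))
      (fderiv ℝ (fderiv ℝ f) (y t₀) (rhs M f (y t₀))) (Icc t₀ t₁) t₀ :=
    (((hf t₀ ht₀).fderiv_right (m := 1) (by norm_num)).differentiableAt
      (by norm_num)).hasFDerivAt.comp_hasDerivWithinAt t₀ (hy t₀ ht₀)
  refine ⟨by rw [iteratedDerivWithin_one]; exact hEq ht₀, ?_⟩
  rw [iteratedDerivWithin_succ', iteratedDerivWithin_congr hEq ht₀, iteratedDerivWithin_one]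
  exact (hf₁.clm_apply hrhs).derivWithin (hI t₀ ht₀)

/-- The expansion behind the correction term. The difference `y - exp(-(t - t₀) M) y₀` solves a
linear equation driven by `f ∘ y`; in its Taylor expansion the terms that contain `M` form the
correction term, and the others form the Taylor expansion of an integral of `f ∘ y`. -/
theorem isBigO_solution_sub_correction [CompleteSpace E] (ht : t₀ < t₁)
    (hf : ∀ t ∈ Icc t₀ t₁, ContDiffAt ℝ 4 f (y t))
    (hy : ∀ t ∈ Icc t₀ t₁, HasDerivWithinAt y (rhs M f (y t)) (Icc t₀ t₁) t)
    (hF : ContDiffOn ℝ 4 (fun t => f (y t)) (Icc t₀ t₁)) :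
    (fun h => y (t₀ + h) - NormedSpace.exp (-(h • M)) (y t₀) - correction M f (y t₀) h
      - ∑ k ∈ Finset.range 4, (h ^ (k + 1) / (k + 1).factorial) •
          iteratedDerivWithin k (fun t => f (y t)) (Icc t₀ t₁) t₀) =O[𝓝[>] 0] fun h => h ^ 5 := by
  have hI : UniqueDiffOn ℝ (Icc t₀ t₁) := uniqueDiffOn_Icc ht
  have ht₀ : t₀ ∈ Icc t₀ t₁ := left_mem_Icc.mpr ht.le
  set F : ℝ → E := fun t => f (y t) with hFdef
  set z : ℝ → E := fun t => y t - NormedSpace.exp ((t - t₀) • -M) (y t₀) with hz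
  have hexp : ∀ t, HasDerivAt (fun t => NormedSpace.exp ((t - t₀) • -M) (y t₀))
      (-M (NormedSpace.exp ((t - t₀) • -M) (y t₀))) t := fun t => by
    have h1 := (hasDerivAt_exp_smul_const' (𝕂 := ℝ) (-M) (t - t₀)).scomp t
      ((hasDerivAt_id t).sub_const t₀)
    simpa using h1.clm_apply (hasDerivAt_const t (y t₀))
  have hode : ∀ t ∈ Icc t₀ t₁, HasDerivWithinAt z ((-M) (z t) + F t) (Icc t₀ t₁) t :=
    fun t h => ((hy t h).sub (hexp t).hasDerivWithinAt).congr_deriv (by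
      simp [rhs, hz, hFdef]; abel)
  have hz5 : ContDiffOn ℝ ((4 : ℕ) + 1) z (Icc t₀ t₁) := by
    have hy5 : ContDiffOn ℝ ((4 : ℕ) + 1) y (Icc t₀ t₁) :=
      contDiffOn_of_autonomous_ode (n := 4) hI (fun t h => contDiffAt_rhs (hf t h)) hy
    have hexp5 : ContDiffOn ℝ ((4 : ℕ) + 1)
        (fun t => NormedSpace.exp ((t - t₀) • -M) (y t₀)) (Icc t₀ t₁) :=
      contDiffOn_of_autonomous_ode (n := 4) (g := fun x => -M x) hI
        (fun t _ => M.contDiff.contDiffAt.neg) fun t _ => (hexp t).hasDerivWithinAt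
    exact hy5.sub hexp5
  have hrec : ∀ k ≤ 4, iteratedDerivWithin (k + 1) z (Icc t₀ t₁) t₀
      = (-M) (iteratedDerivWithin k z (Icc t₀ t₁) t₀) + iteratedDerivWithin k F (Icc t₀ t₁) t₀ :=
    fun k hk => iteratedDerivWithin_succ_of_linear_ode (-M) hI
      (hz5.of_le (by exact_mod_cast (by omega : k ≤ 4 + 1)))
      (hF.of_le (by exact_mod_cast hk)) hode ht₀
  have hz0 : z t₀ = 0 := by simp [hz, NormedSpace.exp_zero]
  obtain ⟨hF1, hF2⟩ := iteratedDerivWithin_comp_solution ht hf hy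
  rw [← hFdef] at hF1 hF2
  refine (hz5.taylor_isBigO ht zero_le_one).congr_left fun h => ?_
  have hexpneg : NormedSpace.exp (-(h • M)) = NormedSpace.exp (h • -M) := by rw [smul_neg]
  simp only [Finset.sum_range_succ, Finset.sum_range_zero, Nat.factorial]
  rw [hrec 3 (by norm_num), hrec 2 (by norm_num), hrec 1 (by norm_num), hrec 0 (by norm_num)]
  simp only [iteratedDerivWithin_zero, hz0, hF1, hF2, correction, hexpneg]
  simp only [hz, hFdef, one_mul, add_sub_cancel_left, map_add, map_neg, map_zero,
    neg_apply]
  push_cast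
  module

/-- The local error of a method that satisfies the order conditions. -/
theorem isBigO_sub_update [CompleteSpace E] {T : TwoStageTableau} (hT : T.OrderConditions)
    (ht : t₀ < t₁) (hf : ∀ t ∈ Icc t₀ t₁, ContDiffAt ℝ 4 f (y t))
    (hy : ∀ t ∈ Icc t₀ t₁, HasDerivWithinAt y (rhs M f (y t)) (Icc t₀ t₁) t)
    {Y : ℝ → Fin 2 → E} (hY : ∀ᶠ h in 𝓝[>] 0, IsStages T M f (y t₀) h (Y h))
    (hYO : ∀ i, (fun h => Y h i - y t₀) =O[𝓝[>] 0] fun h => h) :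
    (fun h => y (t₀ + h) - update T M f (y t₀) h (Y h)) =O[𝓝[>] 0] fun h => h ^ 5 := by
  have hF : ContDiffOn ℝ 4 (fun t => f (y t)) (Icc t₀ t₁) := fun t h =>
    (hf t h).comp_contDiffWithinAt t ((contDiffOn_of_autonomous_ode (n := 4)
      (uniqueDiffOn_Icc ht) (fun t h => contDiffAt_rhs (hf t h)) hy t h).of_le (by norm_num))
  have h1 := isBigO_solution_sub_correction ht hf hy hF
  have h2 := (IsStages.isBigO_sum_sub_exact hT ht hf hy hY hYO).id_smul
  have hQ : ∀ i, _ := fun i =>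
    (hF.of_le (by norm_num : ((3 : ℕ) : WithTop ℕ∞) + 1 ≤ 4)).taylor_isBigO ht (hT.c_nonneg i)
  have h3 := (((hQ 0).const_smul_left (T.b 0)).add ((hQ 1).const_smul_left (T.b 1))).id_smul
  refine ((h1.sub h2).sub h3).congr_left fun h => ?_
  simp only [Finset.sum_range_succ, Finset.sum_range_zero, Pi.smul_apply, Nat.factorial, update]
  generalize iteratedDerivWithin 0 (fun t => f (y t)) (Icc t₀ t₁) t₀ = F₀
  generalize iteratedDerivWithin 1 (fun t => f (y t)) (Icc t₀ t₁) t₀ = F₁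
  generalize iteratedDerivWithin 2 (fun t => f (y t)) (Icc t₀ t₁) t₀ = F₂
  generalize iteratedDerivWithin 3 (fun t => f (y t)) (Icc t₀ t₁) t₀ = F₃
  push_cast
  -- The weights integrate cubic polynomials exactly.
  linear_combination (norm := module) h • (hT.sum_b • F₀) + h ^ 2 • (hT.sum_bc • F₁)
    + (h ^ 3 / 2) • (hT.sum_bcc • F₂) + (h ^ 4 / 6) • (hT.sum_bccc • F₃)

end LocalError

theorem hasOrder_of_orderConditions {T : TwoStageTableau} (hT : T.OrderConditions) :
    HasOrder T 4 := by
  intro m A f t₀ tEnd y _ hf ht hy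
  set M := Matrix.toEuclideanCLM (n := Fin m) (𝕜 := ℝ) A
  -- Near the initial time the solution stays where `f` is smooth.
  obtain ⟨t₁, ht₁, hf₁, hy₁⟩ : ∃ t₁, t₀ < t₁ ∧ (∀ t ∈ Icc t₀ t₁, ContDiffAt ℝ 4 f (y t)) ∧
      ∀ t ∈ Icc t₀ t₁, HasDerivWithinAt y (rhs M f (y t)) (Icc t₀ t₁) t := by
    have hcont := (hy t₀ (left_mem_Icc.mpr ht.le)).continuousWithinAt
    have hev := hcont.eventually (ContDiffAt.eventually hf (by simp))
    rw [nhdsWithin_Icc_eq_nhdsGE ht] at hev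
    obtain ⟨u, hu, hus⟩ := (mem_nhdsGE_iff_exists_Icc_subset).mp hev
    have hle : min u tEnd ≤ tEnd := min_le_right _ _
    refine ⟨min u tEnd, lt_min hu ht, fun t h => hus ⟨h.1, h.2.trans (min_le_left _ _)⟩, ?_⟩
    exact fun t h => (hy t ⟨h.1, h.2.trans hle⟩).mono (Icc_subset_Icc_right hle)
  obtain ⟨ρ, hρ, ⟨B, hB⟩, hex⟩ := eventually_existsUnique_isStages T (M := M)
    (hf.of_le (by norm_num))
  classical
  let Y : ℝ → Fin 2 → EuclideanSpace ℝ (Fin m) := fun h =>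
    if H : ∃ Y : Fin 2 → EuclideanSpace ℝ (Fin m), (∀ i, Y i ∈ Metric.ball (y t₀) ρ) ∧
      IsStages T M f (y t₀) h Y then H.choose else 0
  have hYspec : ∀ᶠ h in 𝓝[>] 0, (∀ i, Y h i ∈ Metric.ball (y t₀) ρ) ∧
      IsStages T M f (y t₀) h (Y h) := hex.mono fun h hh => by
    simp only [Y, dif_pos hh.exists]
    exact hh.exists.choose_spec
  obtain ⟨C, hC⟩ := (isBigO_sub_update hT ht₁ hf₁ hy₁ (hYspec.mono fun h hh => hh.2)
    (IsStages.isBigO_sub hB (hYspec.mono fun h hh => hh.1)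
      (hYspec.mono fun h hh => hh.2))).bound
  obtain ⟨δ, hδ, hsub⟩ := mem_nhdsGT_iff_exists_Ioo_subset.mp (hex.and (hYspec.and hC))
  refine ⟨ρ, hρ, δ, hδ, C, fun h hh hhδ => ?_⟩
  obtain ⟨h1, h2, h3⟩ := hsub ⟨hh, hhδ⟩
  refine ⟨h1, fun Z hZρ hZ => ?_⟩
  rw [h1.unique ⟨hZρ, hZ⟩ h2]
  rwa [Real.norm_of_nonneg (by positivity)] at h3

end IMMVERK

theorem mainTheorem5 :
    (∀ T : TwoStageTableau, T.OrderConditions → IMMVERK.HasOrder T 4) ∧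
    (∀ T : TwoStageTableau, T.OrderConditions ↔
      ∃ σ : Equiv.Perm (Fin 2), T = TwoStageTableau.hammerHollingsworth.relabel σ) ∧
    (∀ T : TwoStageTableau, IMMVERK.HasOrder T 4 ↔
      ∃ σ : Equiv.Perm (Fin 2), T = TwoStageTableau.hammerHollingsworth.relabel σ) := by
  exact ⟨fun _ => IMMVERK.hasOrder_of_orderConditions,
    fun _ => TwoStageTableau.orderConditions_iff,
    fun _ => ⟨fun hT => TwoStageTableau.orderConditions_iff.mp hT.orderConditions,
      fun hT => IMMVERK.hasOrder_of_orderConditions (TwoStageTableau.orderConditions_iff.mpr hT)⟩⟩
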